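/- An mm-space is a triple $X=(X,d_X,\mu_X)$ where $(X,d_X)$ is a complete separable metric space and $\mu_X$ is a Borel probability measure on $X$. Let $I:=[0,1)$ with Lebesgue measure $\mathcal L^1$; a parameter of $X$ is a Borel map $\varphi:I\to X$ with $\varphi_*\mathcal L^1=\mu_X$. The box distance $\Box(X,Y)$ is the infimum of all $\varepsilon>0$ for which there are a Borel set $\tilde I\subset I$ and parameters $\varphi$ of $X$ and $\psi$ of $Y$ with $\mathcal L^1(\tilde I)\ge 1-\varepsilon$ and $|d_X(\varphi(s),\varphi(t))-d_Y(\psi(s),\psi(t))|\le\varepsilon$ for all $s,t\in\tilde I$. A sequence $X_m$ box-converges to $X$ if $\Box(X_m,X)\to 0$; the box topology is the topology induced by $\Box$. An mm-space $Y$ dominates $X$, written $Y\succ X$, if there is a $1$-Lipschitz map $F:Y\to X$ with $F_*\mu_Y=\mu_X$. Let $n\in\mathbb N\cup\{\infty\}$, $\mathbb N_n:=\mathbb N\cap[1,n]$ and $\alpha=(\alpha_i)_{i\in\mathbb N_n}$ with all $\alpha_i\in(0,\infty)$. For an mm-space $X$ put, with values in $[0,\infty]$, $$\operatorname{diam}(X;\alpha):=\inf\Big\{\sup_{i\in\mathbb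 N_n}\operatorname{diam}A_i\Big\},$$ the infimum being over all families $(A_i)_{i\in\mathbb N_n}$ of pairwise disjoint Borel subsets of $X$ with $\mu_X(A_i)\ge\alpha_i$ for all $i$ (and $\inf\emptyset=\infty$), $$\underline{\operatorname{diam}}(X;\alpha):=\inf_{Y\succ X}\operatorname{diam}(Y;\alpha),\qquad \underline{\operatorname{Obsdiam}}(X;\alpha):=\sup\{\underline{\operatorname{diam}}((\mathbb R,f_*\mu_X);\alpha)\mid f:X\to\mathbb R\ \text{is $1$-Lipschitz}\}.$$ **Proposition.** Let $(X_m)_{m\in\mathbb N}$ be a sequence of mm-spaces that box-converges to an mm-space $X$. Then $$\underline{\operatorname{Obsdiam}}(X;\alpha)\le\liminf_{m\to\infty}\underline{\operatorname{Obsdiam}}(X_m;\alpha).$$ In other words, $X\mapsto\underline{\operatorname{Obsdiam}}(X;\alpha)$ is lower semicontinuous with respect to the box topology. -/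

import Mathlib

open MeasureTheory Filter Topology
open scoped ENNReal

universe u

/-- An mm-space: a complete separable metric space with a Borel probability measure. -/
structure MMSpace : Type (u + 1) where
  carrier : Type u
  [metric : MetricSpace carrier]
  [complete : CompleteSpace carrier]
  [separable : TopologicalSpace.SeparableSpace carrier]
  [measurableSpace : MeasurableSpace carrier]
  [borel : BorelSpace carrier]
  μ : Measure carrier
  [isProb : IsProbabilityMeasure μ]

namespace MMSpace

instance : CoeSort MMSpace.{u} (Type u) := ⟨MMSpace.carrier⟩

attribute [instance] MMSpace.metric MMSpace.complete MMSpace.separable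
  MMSpace.measurableSpace MMSpace.borel MMSpace.isProb

/-- Lebesgue measure on `I = [0,1)`. -/
noncomputable def unitLebesgue : Measure (Set.Ico (0 : ℝ) 1) :=
  Measure.comap Subtype.val volume

/-- A parameter of `X`: a Borel map `φ : [0,1) → X` pushing Lebesgue measure on `[0,1)`
forward to the measure of `X`. -/
def IsParameter (X : MMSpace.{u}) (φ : Set.Ico (0 : ℝ) 1 → X) : Prop :=
  Measurable φ ∧ Measure.map φ unitLebesgue = X.μ

/-- The admissibility condition on `ε` in the definition of the box distance. -/
def BoxClose (X Y : MMSpace.{u}) (ε : ℝ) : Prop :=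
  ∃ (I' : Set (Set.Ico (0 : ℝ) 1)) (φ : Set.Ico (0 : ℝ) 1 → X) (ψ : Set.Ico (0 : ℝ) 1 → Y),
    MeasurableSet I' ∧ X.IsParameter φ ∧ Y.IsParameter ψ ∧
    ENNReal.ofReal (1 - ε) ≤ unitLebesgue I' ∧
    ∀ s ∈ I', ∀ t ∈ I', |dist (φ s) (φ t) - dist (ψ s) (ψ t)| ≤ ε

/-- The box distance, as an infimum in `[0,∞]`. -/
noncomputable def boxDist (X Y : MMSpace.{u}) : ℝ≥0∞ :=
  ⨅ (ε : ℝ) (_ : 0 < ε ∧ BoxClose X Y ε), ENNReal.ofReal ε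

/-- `X_m` box-converges to `X`. -/
def BoxTendsto (Xs : ℕ → MMSpace.{u}) (X : MMSpace.{u}) : Prop :=
  Tendsto (fun m => boxDist (Xs m) X) atTop (𝓝 0)

/-- The box topology, on representatives: a set is open if and only if it contains a
box-distance ball around each of its points. -/
instance boxTopology : TopologicalSpace MMSpace.{u} where
  IsOpen U := ∀ X ∈ U, ∃ ε : ℝ≥0∞, 0 < ε ∧ ∀ Y, boxDist X Y < ε → Y ∈ U
  isOpen_univ := fun _ _ => ⟨1, one_pos, fun _ _ => trivial⟩
  isOpen_inter := by
    intro U V hU hV X hX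
    obtain ⟨a, ha, hUa⟩ := hU X hX.1
    obtain ⟨b, hb, hVb⟩ := hV X hX.2
    exact ⟨min a b, lt_min ha hb, fun Y hY =>
      ⟨hUa Y (hY.trans_le (min_le_left _ _)), hVb Y (hY.trans_le (min_le_right _ _))⟩⟩
  isOpen_sUnion := by
    intro S hS X hX
    obtain ⟨U, hU, hXU⟩ := hX
    obtain ⟨a, ha, h⟩ := hS U hU X hXU
    exact ⟨a, ha, fun Y hY => ⟨U, hU, h Y hY⟩⟩

/-- `Y.Dominates X`: there is a `1`-Lipschitz map `Y → X` pushing the measure of `Y` forward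
to the measure of `X`. -/
def Dominates (Y X : MMSpace.{u}) : Prop :=
  ∃ F : Y → X, LipschitzWith 1 F ∧ Measure.map F Y.μ = X.μ

/-- The index set `ℕ ∩ [1, n]` for `n ∈ ℕ ∪ {∞}`. -/
def indexSet (n : ℕ∞) : Set ℕ := {i | 1 ≤ i ∧ (i : ℕ∞) ≤ n}

/-- The set of families of pairwise disjoint Borel subsets `A i` of `X` of measure
at least `α i`. -/
def admissible (X : MMSpace.{u}) {n : ℕ∞} (α : indexSet n → ℝ) : Set (indexSet n → Set X) :=
  {A | (∀ i, MeasurableSet (A i)) ∧ Pairwise (fun i j => Disjoint (A i) (A j)) ∧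
    ∀ i, ENNReal.ofReal (α i) ≤ X.μ (A i)}

/-- `diam(X; α)`; it is `∞` when there is no admissible family. -/
noncomputable def partialDiam (X : MMSpace.{u}) {n : ℕ∞} (α : indexSet n → ℝ) : ℝ≥0∞ :=
  ⨅ A ∈ X.admissible α, ⨆ i, Metric.ediam (A i)

/-- The lower partial diameter: the infimum of `diam(Y; α)` over all mm-spaces `Y`
dominating `X`. -/
noncomputable def lowerPartialDiam (X : MMSpace.{u}) {n : ℕ∞} (α : indexSet n → ℝ) : ℝ≥0∞ :=
  ⨅ (Y : MMSpace.{u}) (_ : Y.Dominates X), Y.partialDiam α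

/-- The mm-space `(ℝ, f_* μ_X)`. -/
noncomputable def pushReal (X : MMSpace.{u}) (f : X → ℝ) (hf : LipschitzWith 1 f) :
    MMSpace.{0} :=
  haveI : IsProbabilityMeasure (Measure.map f X.μ) :=
    Measure.isProbabilityMeasure_map hf.continuous.measurable.aemeasurable
  { carrier := ℝ, μ := Measure.map f X.μ }

/-- The multivariable observable diameter. -/
noncomputable def lowerObsDiam (X : MMSpace.{u}) {n : ℕ∞} (α : indexSet n → ℝ) : ℝ≥0∞ :=
  ⨆ (f : X → ℝ) (hf : LipschitzWith 1 f), (X.pushReal f hf).lowerPartialDiam α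

end MMSpace

/-! For `ν` on `ℝ`, the lower partial diameter is governed by fractional packings: it is at most `2
* r` if `ν` has one of radius `r` (`lowerPartialDiam_le_of_isFractionalPacking`), and being `< 2 *
r` yields one (`isFractionalPacking_of_lowerPartialDiam_lt`). Domination turns disjoint sets into
measures whose sum fits under `ν`, a condition that survives weak limits although disjointness does
not (`IsFractionalPacking.of_tendsto`). If `Y` is box-close to `X`, every 1-Lipschitz `f` on `X` has
a 1-Lipschitz counterpart on `Y` with Prokhorov-close law
(`BoxClose.exists_lipschitzWith_measure_le`). Packings for these laws then converge to one for the
law of `f`. -/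

open Metric in
/-- A fractional packing of `ν` by balls of radius `r`: probability measures `ρ i`, each carried by
a ball of radius `r`, whose multiples `α i • ρ i` fit together under `ν`. -/
def IsFractionalPacking {ι : Type*} (ν : Measure ℝ) (α : ι → ℝ) (r : ℝ) : Prop :=
  ∃ (c : ι → ℝ) (ρ : ι → ProbabilityMeasure ℝ),
    (∀ i, (ρ i : Measure ℝ) (closedBall (c i) r)ᶜ = 0) ∧
    ∀ s : Finset ι, ∑ i ∈ s, ENNReal.ofReal (α i) • (ρ i : Measure ℝ) ≤ ν

/-- Special to the line: the midpoint of the hull is a centre, so passing between diameters and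
radii loses nothing. -/
theorem Real.exists_subset_closedBall_of_ediam_le {S : Set ℝ} {r : ℝ} (hr : 0 ≤ r)
    (h : Metric.ediam S ≤ ENNReal.ofReal (2 * r)) : ∃ c, S ⊆ Metric.closedBall c r := by
  have hb : Bornology.IsBounded S :=
    Metric.isBounded_iff_ediam_ne_top.2 (ne_top_of_le_ne_top ENNReal.ofReal_ne_top h)
  have hd : sSup S - sInf S ≤ 2 * r := by
    rw [← Real.diam_eq hb]
    exact ENNReal.toReal_le_of_le_ofReal (by positivity) h
  refine ⟨(sInf S + sSup S) / 2, fun x hx => ?_⟩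
  have h1 := csInf_le hb.bddBelow hx
  have h2 := le_csSup hb.bddAbove hx
  rw [Metric.mem_closedBall, Real.dist_eq, abs_le]
  constructor <;> linarith

theorem measure_sum_le_of_forall_finset {ι Ω : Type*} [MeasurableSpace Ω] {μ : ι → Measure Ω}
    {ν : Measure Ω} (h : ∀ s : Finset ι, ∑ i ∈ s, μ i ≤ ν) : Measure.sum μ ≤ ν := by
  refine Measure.le_iff.2 fun S hS => ?_
  rw [Measure.sum_apply _ hS, ENNReal.tsum_eq_iSup_sum]
  refine iSup_le fun s => ?_
  simpa using h s S

theorem measure_le_of_forall_isClosed {μ ν : Measure ℝ} [IsFiniteMeasure μ]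
    (h : ∀ F, IsClosed F → μ F ≤ ν F) : μ ≤ ν := by
  refine Measure.le_iff.2 fun S hS => ?_
  rw [hS.measure_eq_iSup_isClosed_of_ne_top (measure_ne_top μ S)]
  exact iSup₂_le fun F hF => iSup_le fun hc => (h F hc).trans (measure_mono hF)

/-! ### Lower partial diameter and fractional packings -/

namespace MMSpace

/-- Push forward `Y.μ` conditioned on each `A i`. The images may overlap, but disjointness upstairs
still bounds the sum. -/
theorem isFractionalPacking_of_admissible {n : ℕ∞} {α : indexSet n → ℝ} (hα : ∀ i, 0 < α i)
    {Y : MMSpace.{u}} {F : Y → ℝ} (hF : LipschitzWith 1 F) {A : indexSet n → Set Y}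
    (hA : A ∈ Y.admissible α) {r : ℝ} (hr : 0 ≤ r)
    (hd : ∀ i, Metric.ediam (A i) ≤ ENNReal.ofReal (2 * r)) :
    IsFractionalPacking (Measure.map F Y.μ) α r := by
  obtain ⟨hm, hdisj, hμ⟩ := hA
  have hFm : Measurable F := hF.continuous.measurable
  have hpos : ∀ i, Y.μ (A i) ≠ 0 := fun i =>
    ((ENNReal.ofReal_pos.2 (hα i)).trans_le (hμ i)).ne'
  have hball : ∀ i, ∃ c, F '' A i ⊆ Metric.closedBall c r := fun i =>
    Real.exists_subset_closedBall_of_ediam_le hr <|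
      (hF.ediam_image_le (A i)).trans (by simpa using hd i)
  choose c hc using hball
  have hprob : ∀ i, IsProbabilityMeasure (Measure.map F (ProbabilityTheory.cond Y.μ (A i))) :=
    fun i => by
      have := ProbabilityTheory.cond_isProbabilityMeasure (hpos i)
      exact Measure.isProbabilityMeasure_map hFm.aemeasurable
  refine ⟨c, fun i => ⟨_, hprob i⟩, fun i => ?_, fun s => Measure.le_iff.2 fun S hS => ?_⟩
  · have hB : MeasurableSet (Metric.closedBall (c i) r)ᶜ :=
      Metric.isClosed_closedBall.measurableSet.compl
    change Measure.map F _ _ = 0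
    rw [Measure.map_apply hFm hB, ProbabilityTheory.cond_apply (hm i)]
    have : A i ∩ F ⁻¹' (Metric.closedBall (c i) r)ᶜ = ∅ := by
      ext x
      simp only [Set.mem_inter_iff, Set.mem_preimage, Set.mem_compl_iff, Set.mem_empty_iff_false,
        iff_false, not_and, not_not]
      exact fun hx => hc i ⟨x, hx, rfl⟩
    rw [this, measure_empty, mul_zero]
  · simp only [ProbabilityMeasure.coe_mk, Measure.coe_finsetSum, Finset.sum_apply,
      Measure.smul_apply, smul_eq_mul]
    rw [Measure.map_apply hFm hS]
    calc ∑ i ∈ s, ENNReal.ofReal (α i) *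
          Measure.map F (ProbabilityTheory.cond Y.μ (A i)) S
        ≤ ∑ i ∈ s, Y.μ (A i ∩ F ⁻¹' S) := by
          refine Finset.sum_le_sum fun i _ => ?_
          rw [Measure.map_apply hFm hS, ProbabilityTheory.cond_apply (hm i), ← mul_assoc]
          refine mul_le_of_le_one_left (zero_le) ?_
          rw [← div_eq_mul_inv]
          exact ENNReal.div_le_of_le_mul (by simpa using hμ i)
      _ = Y.μ (⋃ i ∈ s, A i ∩ F ⁻¹' S) := by
          rw [measure_biUnion_finset]
          · exact fun i _ j _ hij =>
              (hdisj hij).mono Set.inter_subset_left Set.inter_subset_left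
          · exact fun i _ => (hm i).inter (hFm hS)
      _ ≤ Y.μ (F ⁻¹' S) := measure_mono (by simp)

theorem isFractionalPacking_of_lowerPartialDiam_lt {n : ℕ∞} {α : indexSet n → ℝ}
    (hα : ∀ i, 0 < α i) {X : MMSpace.{u}} {f : X → ℝ} (hf : LipschitzWith 1 f) {r : ℝ}
    (hr : 0 ≤ r) (h : (X.pushReal f hf).lowerPartialDiam α < ENNReal.ofReal (2 * r)) :
    IsFractionalPacking (Measure.map f X.μ) α r := by
  simp only [lowerPartialDiam, partialDiam, iInf_lt_iff] at h
  obtain ⟨Y, ⟨F, hF, hFμ⟩, A, hA, hd⟩ := h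
  have := isFractionalPacking_of_admissible (F := F) hα hF hA hr
    fun i => (le_iSup (fun i => Metric.ediam (A i)) i).trans hd.le
  exact (show Measure.map F Y.μ = Measure.map f X.μ from hFμ) ▸ this

theorem lowerPartialDiam_le_of_isFractionalPacking {n : ℕ∞} {α : indexSet n → ℝ}
    {X : MMSpace.{u}} {f : X → ℝ} (hf : LipschitzWith 1 f) {r : ℝ}
    (h : IsFractionalPacking (Measure.map f X.μ) α r) :
    (X.pushReal f hf).lowerPartialDiam α ≤ ENNReal.ofReal (2 * r) := by
  obtain ⟨c, ρ, hρ, hsum⟩ := h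
  set ν := Measure.map f X.μ with hν
  have hνp : IsProbabilityMeasure ν :=
    Measure.isProbabilityMeasure_map hf.continuous.measurable.aemeasurable
  set σ : Measure ℝ := Measure.sum fun i => ENNReal.ofReal (α i) • (ρ i : Measure ℝ) with hσ
  have hσν : σ ≤ ν := measure_sum_le_of_forall_finset hsum
  have : IsFiniteMeasure σ := isFiniteMeasure_of_le ν hσν
  have hsheet : ∀ k : ℕ, Measurable fun x : ℝ => (x, k) := fun k => by fun_prop
  -- Each piece gets its own sheet of `ℝ × ℕ`, so overlapping pieces become disjoint. The leftover
  -- `ν - σ` could go on any sheet, as only lower mass bounds matter.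
  let m : Measure (ℝ × ℕ) :=
    (Measure.sum fun i : indexSet n =>
      Measure.map (fun x => (x, (i : ℕ))) (ENNReal.ofReal (α i) • (ρ i : Measure ℝ))) +
    Measure.map (fun x => (x, 0)) (ν - σ)
  have hfst : Measure.map Prod.fst m = ν := by
    rw [Measure.map_add _ _ measurable_fst, Measure.map_sum measurable_fst.aemeasurable,
      Measure.map_map measurable_fst (hsheet 0)]
    simp only [Measure.map_map measurable_fst (hsheet _), Function.comp_def, Measure.map_id']
    rw [add_comm]
    exact Measure.sub_add_cancel_of_le hσν
  have hm : IsProbabilityMeasure m := by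
    constructor
    rw [← Set.preimage_univ (f := Prod.fst), ← Measure.map_apply measurable_fst MeasurableSet.univ,
      hfst, measure_univ]
  let Y : MMSpace.{0} := { carrier := ℝ × ℕ, μ := m }
  have hY : Y.Dominates (X.pushReal f hf) := ⟨Prod.fst, LipschitzWith.prod_fst, hfst⟩
  refine (iInf₂_le Y hY).trans ?_
  let A : indexSet n → Set (ℝ × ℕ) := fun i => Metric.closedBall (c i) r ×ˢ {(i : ℕ)}
  have hAm : ∀ i, MeasurableSet (A i) := fun i =>
    Metric.isClosed_closedBall.measurableSet.prod (measurableSet_singleton _)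
  have hA : A ∈ Y.admissible α := by
    refine ⟨hAm, fun i j hij => ?_, fun i => ?_⟩
    · refine Set.disjoint_left.2 fun x hx hx' => hij (Subtype.ext ?_)
      exact hx.2.symm.trans hx'.2
    · change _ ≤ m (A i)
      refine le_trans ?_ (Measure.le_add_right le_rfl (A i))
      refine le_trans ?_ (Measure.le_sum _ i (A i))
      rw [Measure.map_apply (hsheet _) (hAm i)]
      have : (fun x : ℝ => (x, (i : ℕ))) ⁻¹' A i = Metric.closedBall (c i) r := by
        ext x; simp [A]
      rw [this, Measure.smul_apply,
        (prob_compl_eq_zero_iff Metric.isClosed_closedBall.measurableSet).1 (hρ i)]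
      simp
  refine (iInf₂_le A hA).trans (iSup_le fun i => Metric.ediam_le fun x hx y hy => ?_)
  change edist (x : ℝ × ℕ) y ≤ _
  rw [Prod.edist_eq, show x.2 = y.2 from hx.2.trans hy.2.symm, edist_self, max_eq_left zero_le,
    edist_dist]
  refine ENNReal.ofReal_le_ofReal ?_
  have := dist_triangle_right x.1 y.1 (c i)
  have h1 : dist x.1 (c i) ≤ r := hx.1
  have h2 : dist y.1 (c i) ≤ r := hy.1
  linarith

end MMSpace
-- Transfer of 1-Lipschitz functions under box-closeness
namespace MMSpace

theorem BoxClose.symm {X Y : MMSpace.{u}} {ε : ℝ} (h : X.BoxClose Y ε) : Y.BoxClose X ε := by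
  obtain ⟨I', φ, ψ, hI, hφ, hψ, hμ, hd⟩ := h
  exact ⟨I', ψ, φ, hI, hψ, hφ, hμ, fun s hs t ht => abs_sub_comm (dist (φ s) (φ t)) _ ▸ hd s hs t ht⟩

theorem BoxClose.mono {X Y : MMSpace.{u}} {ε δ : ℝ} (h : X.BoxClose Y ε) (hεδ : ε ≤ δ) :
    X.BoxClose Y δ := by
  obtain ⟨I', φ, ψ, hI, hφ, hψ, hμ, hd⟩ := h
  exact ⟨I', φ, ψ, hI, hφ, hψ, (ENNReal.ofReal_le_ofReal (by linarith)).trans hμ,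
    fun s hs t ht => (hd s hs t ht).trans hεδ⟩

theorem boxClose_of_boxDist_lt {X Y : MMSpace.{u}} {ε : ℝ}
    (h : X.boxDist Y < ENNReal.ofReal ε) : X.BoxClose Y ε := by
  simp only [boxDist, iInf_lt_iff] at h
  obtain ⟨δ, ⟨-, hδ⟩, hlt⟩ := h
  exact hδ.mono (ENNReal.ofReal_lt_ofReal_iff'.1 hlt).1.le

theorem BoxClose.exists_lipschitzWith_measure_le {Y X : MMSpace.{u}} {ε : ℝ}
    (h : Y.BoxClose X ε) (hε1 : ε < 1) {f : X → ℝ} (hf : LipschitzWith 1 f) :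
    ∃ g : Y → ℝ, LipschitzWith 1 g ∧ ∀ S, MeasurableSet S →
      Measure.map g Y.μ S ≤ Measure.map f X.μ (Metric.cthickening ε S) + ENNReal.ofReal ε := by
  obtain ⟨I', φ, ψ, hI, ⟨hφ, hφμ⟩, ⟨hψ, hψμ⟩, hμ, hd⟩ := h
  have huniv : unitLebesgue Set.univ = 1 := by
    rw [← Set.preimage_univ (f := φ), ← Measure.map_apply hφ MeasurableSet.univ, hφμ, measure_univ]
  have : IsProbabilityMeasure unitLebesgue := ⟨huniv⟩
  -- `ε < 1` enters here; the infimum defining `g` needs a nonempty index set.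
  have hne : Nonempty I' := by
    rw [Set.nonempty_coe_sort, Set.nonempty_iff_ne_empty]
    rintro rfl
    rw [measure_empty, nonpos_iff_eq_zero, ENNReal.ofReal_eq_zero] at hμ
    linarith
  have hfd : ∀ x y, |f x - f y| ≤ dist x y := fun x y => by
    simpa [Real.dist_eq] using hf.dist_le_mul x y
  -- McShane extension of `φ s ↦ f (ψ s)`, which is 1-Lipschitz only up to the additive error `ε`;
  -- hence `g ∘ φ` is within `ε` of `f ∘ ψ` on `I'`.
  let e : I' → Y → ℝ := fun s y => f (ψ s) + dist y (φ s)
  have hlow : ∀ s t : I', f (ψ t) - ε ≤ e s (φ t) := fun s t => by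
    have h1 := (abs_le.1 (hfd (ψ s) (ψ t))).1
    have h2 := (abs_le.1 (hd t t.2 s s.2)).1
    have h3 := dist_comm (ψ s) (ψ t)
    simp only [e]
    linarith
  have hlip : ∀ (s : I') (y z : Y), e s y ≤ e s z + dist y z := fun s y z => by
    have := dist_triangle y z (φ s)
    simp only [e]
    linarith
  obtain ⟨t₀⟩ := id hne
  have hbdd : ∀ y, BddBelow (Set.range fun s => e s y) := fun y => by
    refine ⟨f (ψ t₀) - ε - dist (φ t₀) y, ?_⟩
    rintro _ ⟨s, rfl⟩
    have := hlow s t₀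
    have := hlip s (φ t₀) y
    simp only
    linarith
  let g : Y → ℝ := fun y => ⨅ s, e s y
  have hg : LipschitzWith 1 g := by
    refine LipschitzWith.of_le_add fun y z => ?_
    rw [← sub_le_iff_le_add]
    refine le_ciInf fun s => ?_
    have := ciInf_le (hbdd y) s
    have := hlip s y z
    simp only [g]
    linarith
  have hclose : ∀ t ∈ I', |f (ψ t) - g (φ t)| ≤ ε := fun t ht => by
    have hε0 : 0 ≤ ε := (abs_nonneg _).trans (hd t ht t ht)
    have h1 : g (φ t) ≤ f (ψ t) := by
      simpa [e] using ciInf_le (hbdd (φ t)) (⟨t, ht⟩ : I')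
    have h2 : f (ψ t) - ε ≤ g (φ t) := le_ciInf fun s => hlow s ⟨t, ht⟩
    rw [abs_le]
    constructor <;> linarith
  refine ⟨g, hg, fun S hS => ?_⟩
  have hgm : Measurable g := hg.continuous.measurable
  have hfm : Measurable f := hf.continuous.measurable
  have hT : MeasurableSet (Metric.cthickening ε S) := Metric.isClosed_cthickening.measurableSet
  rw [← hφμ, ← hψμ, Measure.map_map hgm hφ, Measure.map_map hfm hψ,
    Measure.map_apply (hgm.comp hφ) hS, Measure.map_apply (hfm.comp hψ) hT]
  have hsub : (g ∘ φ) ⁻¹' S ⊆ (f ∘ ψ) ⁻¹' (Metric.cthickening ε S) ∪ I'ᶜ := fun t ht => by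
    by_cases htI : t ∈ I'
    · exact Or.inl (Metric.mem_cthickening_of_dist_le _ _ _ _ ht
        (by rw [Real.dist_eq]; exact hclose t htI))
    · exact Or.inr htI
  have hcompl : unitLebesgue I'ᶜ ≤ ENNReal.ofReal ε := by
    rw [prob_compl_eq_one_sub hI, tsub_le_iff_right]
    calc (1 : ℝ≥0∞) = ENNReal.ofReal (ε + (1 - ε)) := by simp
      _ ≤ ENNReal.ofReal ε + ENNReal.ofReal (1 - ε) := ENNReal.ofReal_add_le
      _ ≤ _ := by gcongr
  exact (measure_mono hsub).trans ((measure_union_le _ _).trans (by gcongr))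

end MMSpace

/-! ### Limits of fractional packings -/

theorem ProbabilityMeasure.exists_tendsto_of_eventually_compl_eq_zero {κ : Type*}
    (U : Ultrafilter κ) {ρ : κ → ProbabilityMeasure ℝ} {K : Set ℝ} (hK : IsCompact K)
    (h : ∀ᶠ k in U, (ρ k : Measure ℝ) Kᶜ = 0) : ∃ ρ', Tendsto ρ U (𝓝 ρ') := by
  have hT : IsCompact (closure {μ : ProbabilityMeasure ℝ | (μ : Measure ℝ) Kᶜ = 0}) := by
    refine isCompact_closure_of_isTightMeasureSet
      (isTightMeasureSet_iff_exists_isCompact_measure_compl_le.2 fun ε _ => ⟨K, hK, ?_⟩)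
    rintro _ ⟨μ, hμ, rfl⟩
    exact (show (μ : Measure ℝ) Kᶜ = 0 from hμ) ▸ zero_le
  obtain ⟨ρ', -, hρ'⟩ := hT.ultrafilter_le_nhds (U.map ρ) (by
    rw [le_principal_iff]
    exact h.mono fun k hk => subset_closure hk)
  exact ⟨ρ', hρ'⟩

/-- Fractional packings pass to limits: if measures `ν k` which converge to `ν` in the sense of the
Prokhorov distance have fractional packings by balls of radius `r`, then so has `ν`. -/
theorem IsFractionalPacking.of_tendsto {ι : Type*} {ν : Measure ℝ} [IsProbabilityMeasure ν]
    {α : ι → ℝ} (hα : ∀ i, 0 < α i) {r : ℝ} (hr : 0 ≤ r) {νs : ℕ → Measure ℝ} {ε : ℕ → ℝ}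
    (hε : Tendsto ε atTop (𝓝 0))
    (hν : ∀ k S, MeasurableSet S → νs k S ≤ ν (Metric.cthickening (ε k) S) + ENNReal.ofReal (ε k))
    (h : ∀ k, IsFractionalPacking (νs k) α r) : IsFractionalPacking ν α r := by
  choose c ρ hρ hsum using h
  -- One ultrafilter gives limits for all `i` at once, replacing a diagonal subsequence.
  let U : Ultrafilter ℕ := hyperfilter ℕ
  have hU : (U : Filter ℕ) ≤ atTop := Nat.hyperfilter_le_atTop
  have hεU : Tendsto ε U (𝓝 0) := hε.mono_left hU
  have hmass : ∀ k i S, ENNReal.ofReal (α i) * (ρ k i : Measure ℝ) S ≤ νs k S := fun k i S => by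
    simpa using hsum k {i} S
  -- the centres stay in a compact set
  have hcent : ∀ i, ∃ M : ℝ, ∀ᶠ k in U, c k i ∈ Metric.closedBall (0 : ℝ) M := fun i => by
    have hM : ∃ M : ℝ, ν (Metric.closedBall 0 M)ᶜ < ENNReal.ofReal (α i / 2) := by
      have := tendsto_measure_compl_closedBall_of_isTightMeasureSet
        (isTightMeasureSet_singleton (μ := ν)) 0
      simp only [iSup_singleton] at this
      exact (this.eventually_lt_const (ENNReal.ofReal_pos.2 (half_pos (hα i)))).exists
    obtain ⟨M, hM⟩ := hM
    -- With a centre farther out and `ε k < 1`, the thickened ball misses `closedBall 0 M`, so `α i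
    -- < α i / 2 + α i / 2`.
    refine ⟨M + 1 + r, ?_⟩
    filter_upwards [hεU.eventually_lt_const (half_pos (hα i)),
      hεU.eventually_lt_const one_pos] with k hk hk1
    by_contra hck
    have hfar : Metric.cthickening (ε k) (Metric.closedBall (c k i) r) ⊆
        (Metric.closedBall 0 M)ᶜ := fun x hx => by
      have hx' : x ∈ Metric.cthickening 1 (Metric.closedBall (c k i) r) :=
        Metric.cthickening_mono hk1.le _ hx
      rw [cthickening_closedBall zero_le_one hr, Metric.mem_closedBall] at hx'
      intro hxM
      rw [Metric.mem_closedBall] at hxM hck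
      have := dist_triangle_left (c k i) 0 x
      linarith
    have hone : (ρ k i : Measure ℝ) (Metric.closedBall (c k i) r) = 1 :=
      (prob_compl_eq_zero_iff Metric.isClosed_closedBall.measurableSet).1 (hρ k i)
    have h1 := (hmass k i (Metric.closedBall (c k i) r)).trans
      (hν k _ Metric.isClosed_closedBall.measurableSet)
    rw [hone, mul_one] at h1
    have h2 := ENNReal.add_lt_add ((measure_mono hfar).trans_lt hM)
      ((ENNReal.ofReal_lt_ofReal_iff (half_pos (hα i))).2 hk)
    rw [← ENNReal.ofReal_add (half_pos (hα i)).le (half_pos (hα i)).le, add_halves] at h2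
    exact absurd h1 h2.not_ge
  choose M hM using hcent
  have hclim : ∀ i, ∃ c', Tendsto (fun k => c k i) U (𝓝 c') := fun i => by
    obtain ⟨c', -, hc'⟩ := (isCompact_closedBall (0 : ℝ) (M i)).ultrafilter_le_nhds
      (U.map fun k => c k i) (by rw [le_principal_iff]; exact hM i)
    exact ⟨c', hc'⟩
  choose c' hc' using hclim
  have hnear : ∀ i δ, 0 < δ →
      ∀ᶠ k in U, (ρ k i : Measure ℝ) (Metric.closedBall (c' i) (r + δ))ᶜ = 0 := fun i δ hδ => by
    filter_upwards [(hc' i).eventually (Metric.closedBall_mem_nhds _ hδ)] with k hk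
    refine measure_mono_null (Set.compl_subset_compl.2 ?_) (hρ k i)
    exact Metric.closedBall_subset_closedBall' (add_le_add_right hk r)
  have hρlim : ∀ i, ∃ ρ', Tendsto (fun k => ρ k i) U (𝓝 ρ') := fun i =>
    ProbabilityMeasure.exists_tendsto_of_eventually_compl_eq_zero U
      (isCompact_closedBall (c' i) (r + 1)) (hnear i 1 one_pos)
  choose ρ' hρ' using hρlim
  have hopen : ∀ i G, IsOpen G → ∃ L, Tendsto (fun k => (ρ k i : Measure ℝ) G) U (𝓝 L) ∧
      (ρ' i : Measure ℝ) G ≤ L := fun i G hG => by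
    obtain ⟨L, -, hL⟩ := isCompact_univ.ultrafilter_le_nhds
      (U.map fun k => (ρ k i : Measure ℝ) G) (by simp)
    have hL' : Tendsto (fun k => (ρ k i : Measure ℝ) G) U (𝓝 L) := hL
    exact ⟨L, hL', (ProbabilityMeasure.le_liminf_measure_open_of_tendsto (hρ' i) hG).trans
      hL'.liminf_eq.le⟩
  refine ⟨c', ρ', fun i => ?_, fun s => ?_⟩
  · have hfar : ∀ δ, 0 < δ → (ρ' i : Measure ℝ) (Metric.closedBall (c' i) (r + δ))ᶜ = 0 :=
      fun δ hδ => by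
        obtain ⟨L, hL, hle⟩ := hopen i _
          (Metric.isClosed_closedBall (x := c' i) (ε := r + δ)).isOpen_compl
        have : L = 0 := tendsto_nhds_unique hL (tendsto_const_nhds.congr' <|
          (hnear i δ hδ).mono fun k hk => hk.symm)
        exact le_antisymm (this ▸ hle) zero_le
    refine measure_mono_null (fun x hx => ?_) (measure_iUnion_null fun j : ℕ =>
      hfar (1 / ((j : ℝ) + 1)) Nat.one_div_pos_of_nat)
    rw [Set.mem_compl_iff, Metric.mem_closedBall, not_le] at hx
    obtain ⟨j, hj⟩ := exists_nat_one_div_lt (sub_pos.2 hx)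
    refine Set.mem_iUnion.2 ⟨j, ?_⟩
    rw [Set.mem_compl_iff, Metric.mem_closedBall, not_le]
    linarith
  · have : ∀ i, IsFiniteMeasure (ENNReal.ofReal (α i) • (ρ' i : Measure ℝ)) := fun i =>
      Measure.smul_finite _ ENNReal.ofReal_ne_top
    refine measure_le_of_forall_isClosed fun F hF => ?_
    -- One `δ` makes `F` open for the portmanteau bound, the other absorbs `ε k`.
    have hbound : ∀ δ, 0 < δ → (∑ i ∈ s, ENNReal.ofReal (α i) • (ρ' i : Measure ℝ)) F ≤
        ν (Metric.cthickening (δ + δ) F) := fun δ hδ => by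
      have hG : IsOpen (Metric.thickening δ F) := Metric.isOpen_thickening
      choose L hL hle using fun i => hopen i _ hG
      calc (∑ i ∈ s, ENNReal.ofReal (α i) • (ρ' i : Measure ℝ)) F
          ≤ (∑ i ∈ s, ENNReal.ofReal (α i) • (ρ' i : Measure ℝ)) (Metric.thickening δ F) :=
            measure_mono (Metric.self_subset_thickening hδ F)
        _ ≤ ∑ i ∈ s, ENNReal.ofReal (α i) * L i := by
            simp only [Measure.coe_finsetSum, Finset.sum_apply, Measure.smul_apply, smul_eq_mul]
            gcongr with i _
            exact hle i
        _ ≤ ν (Metric.cthickening (δ + δ) F) + ENNReal.ofReal 0 := by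
            refine le_of_tendsto_of_tendsto (tendsto_finsetSum s fun i _ =>
              ENNReal.Tendsto.const_mul (hL i) (Or.inr ENNReal.ofReal_ne_top))
              (tendsto_const_nhds.add (ENNReal.tendsto_ofReal hεU)) ?_
            filter_upwards [hεU.eventually_lt_const hδ] with k hk
            have h1 := hsum k s (Metric.thickening δ F)
            simp only [Measure.coe_finsetSum, Finset.sum_apply, Measure.smul_apply,
              smul_eq_mul] at h1
            refine h1.trans ((hν k _ hG.measurableSet).trans ?_)
            gcongr
            exact (Metric.cthickening_mono hk.le _).trans
              ((Metric.cthickening_thickening_subset hδ.le δ F))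
        _ = ν (Metric.cthickening (δ + δ) F) := by simp
    have hlim : Tendsto (fun δ : ℝ => ν (Metric.cthickening (δ + δ) F)) (𝓝[>] 0) (𝓝 (ν F)) := by
      refine (tendsto_measure_cthickening_of_isClosed
        ⟨1, one_pos, measure_ne_top _ _⟩ hF).comp ?_
      have : Tendsto (fun δ : ℝ => δ + δ) (𝓝 0) (𝓝 (0 + 0)) := tendsto_id.add tendsto_id
      rw [add_zero] at this
      exact this.mono_left nhdsWithin_le_nhds
    exact ge_of_tendsto hlim (eventually_mem_nhdsWithin.mono fun δ hδ => hbound δ hδ)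
-- Semicontinuity
namespace MMSpace

theorem lowerObsDiam_le_of_forall_boxClose {n : ℕ∞} {α : indexSet n → ℝ} (hα : ∀ i, 0 < α i)
    {X : MMSpace.{u}} {y : ℝ≥0∞}
    (h : ∀ ε : ℝ, 0 < ε → ∃ Y : MMSpace.{u}, Y.BoxClose X ε ∧ Y.lowerObsDiam α ≤ y) :
    X.lowerObsDiam α ≤ y := by
  refine iSup₂_le fun f hf => ENNReal.le_of_forall_pos_le_add fun δ hδ hy => ?_
  -- The slack `δ` supplies the strict inequality needed to extract a packing.
  have hr : 0 ≤ (y + δ).toReal / 2 := by positivity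
  have hr2 : ENNReal.ofReal (2 * ((y + δ).toReal / 2)) = y + δ := by
    rw [mul_div_cancel₀ _ two_ne_zero, ENNReal.ofReal_toReal (by simp [hy.ne])]
  have : IsProbabilityMeasure (Measure.map f X.μ) :=
    Measure.isProbabilityMeasure_map hf.continuous.measurable.aemeasurable
  -- The shift to `k + 1` keeps the error below `1`.
  have key : ∀ k : ℕ, ∃ ν : Measure ℝ, IsFractionalPacking ν α ((y + δ).toReal / 2) ∧
      ∀ S, MeasurableSet S → ν S ≤ Measure.map f X.μ (Metric.cthickening (1 / ((k + 1 : ℕ) + 1)) S)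
        + ENNReal.ofReal (1 / ((k + 1 : ℕ) + 1)) := fun k => by
    obtain ⟨Y, hYX, hY⟩ := h (1 / ((k + 1 : ℕ) + 1)) Nat.one_div_pos_of_nat
    obtain ⟨g, hg, hgS⟩ := hYX.exists_lipschitzWith_measure_le
      (by rw [div_lt_one (by positivity)]; push_cast; linarith [k.cast_nonneg (α := ℝ)]) hf
    refine ⟨_, isFractionalPacking_of_lowerPartialDiam_lt hα hg hr ?_, hgS⟩
    rw [hr2]
    exact ((le_iSup₂ (f := fun f hf => (Y.pushReal f hf).lowerPartialDiam α) g hg).trans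
      hY).trans_lt (ENNReal.lt_add_right hy.ne (by simpa using hδ.ne'))
  choose ν hν hνS using key
  rw [← hr2]
  exact lowerPartialDiam_le_of_isFractionalPacking hf <| IsFractionalPacking.of_tendsto hα hr
    (tendsto_one_div_add_atTop_nhds_zero_nat.comp (tendsto_add_atTop_nat 1)) hνS hν

end MMSpace

theorem mainTheorem6 (n : ℕ∞) (α : MMSpace.indexSet n → ℝ) (hα : ∀ i, 0 < α i) :
    (∀ (Xs : ℕ → MMSpace.{u}) (X : MMSpace.{u}), MMSpace.BoxTendsto Xs X →
      X.lowerObsDiam α ≤ liminf (fun m => (Xs m).lowerObsDiam α) atTop) ∧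
    LowerSemicontinuous (fun X : MMSpace.{u} => X.lowerObsDiam α) := by
  refine ⟨fun Xs X h => ?_, lowerSemicontinuous_iff_isOpen_preimage.2 fun y X hX => ?_⟩
  · refine le_of_forall_gt_imp_ge_of_dense fun y hy => ?_
    refine MMSpace.lowerObsDiam_le_of_forall_boxClose hα fun ε hε => ?_
    have hfreq := frequently_lt_of_liminf_lt (by isBoundedDefault) hy
    obtain ⟨m, hm, hmε⟩ :=
      (hfreq.and_eventually (h.eventually_lt_const (ENNReal.ofReal_pos.2 hε))).exists
    exact ⟨Xs m, MMSpace.boxClose_of_boxDist_lt hmε, hm.le⟩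
  -- Otherwise every box ball around `X` contains a space with value at most `y`.
  · by_contra! hcon
    refine (MMSpace.lowerObsDiam_le_of_forall_boxClose hα fun ε hε => ?_).not_gt hX
    obtain ⟨Y, hY, hYy⟩ := hcon (ENNReal.ofReal ε) (ENNReal.ofReal_pos.2 hε)
    exact ⟨Y, (MMSpace.boxClose_of_boxDist_lt hY).symm, not_lt.1 hYy⟩
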